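/- Let $n\ge 1$ and let $P:M_n(\mathbb{C})\to M_n(\mathbb{C})$ be a completely positive (linear) map. Let $E_P=M_n(\mathbb{C})\otimes_P M_n(\mathbb{C})$ be its GNS $C^*$-correspondence over $M_n(\mathbb{C})$: the algebraic tensor product $M_n(\mathbb{C})\otimes_{\mathbb{C}} M_n(\mathbb{C})$ with the $M_n(\mathbb{C})$-valued inner product determined by $\langle a_1\otimes b_1,a_2\otimes b_2\rangle=b_1^*P(a_1^*a_2)b_2$, divided by the vectors of length zero, with $M_n(\mathbb{C})$ acting by left multiplication on the first and by right multiplication on the second tensor factor. Then $P$ can be written in the form $P(a)=\sum_{r=1}^N t_r a t_r^*$ for some $N\ge 0$ and $t_1,\dots,t_N\in M_n(\mathbb{C})$; the dimension of the linear span of $t_1,\dots,t_N$ is the same for all such representations of $P$, and is called the index $d(P)$ of $P$; and $E_P$ is strongly Morita equivalent to the Hilbert space $\mathbb{C}^{d(P)}$, regarded as a $C^*$-correspondence over $\mathbb{C}$. Here a $C^*$-correspondence $E$ over $A$ and a $C^*$-correspondence $F$ over $B$ are called strongly Morita equivalent if there are an $A$-$B$ equivalence (imprimitivity) bimodule $X$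 and an isomorphism of $C^*$-correspondences from $A$ to $B$ (a bijective $A$-$B$-bimodule map preserving the $B$-valued inner products) $E\otimes_A X\cong X\otimes_B F$, where $\otimes_A$ and $\otimes_B$ are the interior tensor products of $C^*$-correspondences. -/

import Mathlib

open scoped CStarAlgebra ComplexOrder MatrixOrder Matrix.Norms.L2Operator TensorProduct

universe u

/-- A *pre-correspondence* from `A` to `B`: a complex vector space with commuting actions of `A` (on
the left) and of `B` (on the right), and a `B`-valued semi-inner product (linear in the second
variable) for which the left action is by adjointable operators. -/
structure PreCorrespondence (A B : Type u) [CStarAlgebra A] [CStarAlgebra B] [PartialOrder B]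
    [StarOrderedRing B] where
  /-- the underlying vector space -/
  carrier : Type u
  [addCommGroup : AddCommGroup carrier]
  [module : Module ℂ carrier]
  /-- the left action `a · x` -/
  left : A →ₐ[ℂ] Module.End ℂ carrier
  /-- the right action `x · b`, an anti-homomorphism -/
  right : Bᵐᵒᵖ →ₐ[ℂ] Module.End ℂ carrier
  /-- the `B`-valued semi-inner product -/
  inner : carrier → carrier → B
  inner_add_right : ∀ x y z, inner x (y + z) = inner x y + inner x z
  inner_smul_right : ∀ (c : ℂ) x y, inner x (c • y) = c • inner x y
  star_inner : ∀ x y, star (inner x y) = inner y x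
  inner_self_nonneg : ∀ x, 0 ≤ inner x x
  inner_right : ∀ x y b, inner x (right (MulOpposite.op b) y) = inner x y * b
  inner_left : ∀ a x y, inner (left a x) y = inner x (left (star a) y)

attribute [instance] PreCorrespondence.addCommGroup PreCorrespondence.module

/-- A *C⋆-correspondence* from `A` to `B` (over `A` when `A = B`): a right Hilbert C⋆-module over
`B`, i.e. a right `B`-module with a `B`-valued inner product (linear in the second variable) which
is complete in the norm `‖x‖ = ‖⟨x, x⟩‖ ^ (1 / 2)`, together with a unital ⋆-homomorphism of `A`
into the adjointable operators on it. -/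
structure Correspondence (A B : Type u) [CStarAlgebra A] [CStarAlgebra B] [PartialOrder B]
    [StarOrderedRing B] where
  /-- the underlying Banach space -/
  carrier : Type u
  [normedAddCommGroup : NormedAddCommGroup carrier]
  [normedSpace : NormedSpace ℂ carrier]
  [completeSpace : CompleteSpace carrier]
  /-- the left action `a · x` -/
  left : A →ₐ[ℂ] Module.End ℂ carrier
  /-- the right action `x · b`, an anti-homomorphism -/
  right : Bᵐᵒᵖ →ₐ[ℂ] Module.End ℂ carrier
  /-- the `B`-valued inner product -/
  inner : carrier → carrier → B
  inner_add_right : ∀ x y z, inner x (y + z) = inner x y + inner x z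
  inner_smul_right : ∀ (c : ℂ) x y, inner x (c • y) = c • inner x y
  star_inner : ∀ x y, star (inner x y) = inner y x
  inner_self_nonneg : ∀ x, 0 ≤ inner x x
  inner_right : ∀ x y b, inner x (right (MulOpposite.op b) y) = inner x y * b
  inner_left : ∀ a x y, inner (left a x) y = inner x (left (star a) y)
  norm_eq : ∀ x, ‖x‖ = √‖inner x x‖

attribute [instance] Correspondence.normedAddCommGroup Correspondence.normedSpace
  Correspondence.completeSpace

/-- The extension of bounded operators on a seminormed space to its completion. -/
noncomputable def completionEnd (V : Type u) [SeminormedAddCommGroup V] [NormedSpace ℂ V] :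
    (V →L[ℂ] V) →ₐ[ℂ] Module.End ℂ (UniformSpace.Completion V) :=
  have ext_coe : ∀ {S T : UniformSpace.Completion V → UniformSpace.Completion V},
      Continuous S → Continuous T → (∀ x : V, S x = T x) → ∀ x, S x = T x :=
    fun hS hT h x => UniformSpace.Completion.induction_on x (isClosed_eq hS hT) h
  AlgHom.ofLinearMap
    { toFun := fun T => (T.completion : UniformSpace.Completion V →ₗ[ℂ] UniformSpace.Completion V)
      map_add' := fun S T => LinearMap.ext <| ext_coe (S + T).completion.continuous
        (S.completion.continuous.add T.completion.continuous) fun x => by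
          simp [UniformSpace.Completion.coe_add]
      map_smul' := fun c T => LinearMap.ext <| ext_coe (c • T).completion.continuous
        (T.completion.continuous.const_smul c) fun x => by
          simp [UniformSpace.Completion.coe_smul] }
    (LinearMap.ext <| ext_coe (1 : V →L[ℂ] V).completion.continuous continuous_id
      fun x => by simp)
    fun S T => LinearMap.ext <| ext_coe (S * T).completion.continuous
      (S.completion.continuous.comp T.completion.continuous) fun x => by simp

namespace PreCorrespondence

variable {A B : Type u} [CStarAlgebra A] [CStarAlgebra B] [PartialOrder B] [StarOrderedRing B]
  (V : PreCorrespondence A B)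

theorem inner_add_left (x y z : V.carrier) : V.inner (x + y) z = V.inner x z + V.inner y z := by
  rw [← V.star_inner z, V.inner_add_right, star_add, V.star_inner, V.star_inner]

theorem inner_smul_left (c : ℂ) (x y : V.carrier) :
    V.inner (c • x) y = star c • V.inner x y := by
  rw [← V.star_inner y, V.inner_smul_right, star_smul, V.star_inner]

theorem inner_right_left (x y : V.carrier) (b : B) :
    V.inner (V.right (MulOpposite.op b) x) y = star b * V.inner x y := by
  rw [← V.star_inner y, V.inner_right, star_mul, V.star_inner]

/-- The semi-inner product as a sesquilinear map. -/
noncomputable def innerₛₗ : V.carrier →ₗ⋆[ℂ] V.carrier →ₗ[ℂ] B :=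
  LinearMap.mk₂'ₛₗ _ _ V.inner V.inner_add_left V.inner_smul_left V.inner_add_right
    V.inner_smul_right

theorem innerₛₗ_apply (x y : V.carrier) : V.innerₛₗ x y = V.inner x y := rfl

/-- The Cauchy–Schwarz inequality. -/
theorem norm_inner_sq_le (x y : V.carrier) :
    ‖V.inner x y‖ ^ 2 ≤ ‖V.inner x x‖ * ‖V.inner y y‖ := by
  set a := V.inner x y with ha
  have key : ∀ s : ℝ, 0 ≤ (‖V.inner x x‖ * ‖a‖ ^ 2) * (s * s) + (-2 * ‖a‖ ^ 2) * s
      + ‖V.inner y y‖ := by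
    intro s
    by_cases hs : 0 ≤ 2 * s - s ^ 2 * ‖V.inner x x‖
    · have h1 : 0 ≤ V.inner ((s : ℂ) • V.right (MulOpposite.op a) x - y)
          ((s : ℂ) • V.right (MulOpposite.op a) x - y) := V.inner_self_nonneg _
      have h2 : V.inner ((s : ℂ) • V.right (MulOpposite.op a) x - y)
          ((s : ℂ) • V.right (MulOpposite.op a) x - y)
          = s ^ 2 • (star a * V.inner x x * a) - (2 * s) • (star a * a) + V.inner y y := by
        have e1 : V.inner y x = star a := by rw [ha, V.star_inner]
        have e : ∀ p q : V.carrier, V.inner (p - q) (p - q)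
            = V.inner p p - V.inner p q - V.inner q p + V.inner q q := by
          intro p q
          simp only [← innerₛₗ_apply, map_sub, LinearMap.sub_apply]
          abel
        rw [e, V.inner_smul_left, V.inner_smul_right, V.inner_smul_left, V.inner_smul_right,
          V.inner_right_left, V.inner_right_left, V.inner_right, V.inner_right, e1, ← ha]
        simp only [Complex.star_def, Complex.conj_ofReal, Complex.coe_smul, ← mul_assoc, smul_smul]
        rw [← sq, two_mul, add_smul]
        abel
      have h3 : s ^ 2 • (star a * V.inner x x * a) ≤
          s ^ 2 • (‖V.inner x x‖ • (star a * a)) :=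
        smul_le_smul_of_nonneg_left (CStarAlgebra.star_left_conjugate_le_norm_smul
          (V.star_inner x x)) (sq_nonneg s)
      have h4 : (2 * s - s ^ 2 * ‖V.inner x x‖) • (star a * a) ≤ V.inner y y := by
        rw [h2] at h1
        have h5 := h1.trans (add_le_add_left (sub_le_sub_right h3 ((2 * s) • (star a * a)))
          (V.inner y y))
        rw [← sub_nonneg]
        convert h5 using 1
        rw [sub_smul, smul_smul]
        abel
      have h6 := CStarAlgebra.norm_le_norm_of_nonneg_of_le
        (smul_nonneg hs (star_mul_self_nonneg a)) h4
      rw [norm_smul, CStarRing.norm_star_mul_self, Real.norm_of_nonneg hs] at h6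
      nlinarith
    · push Not at hs
      have := norm_nonneg (V.inner y y)
      nlinarith [mul_nonneg (neg_nonneg.2 hs.le) (sq_nonneg ‖a‖)]
  have hd := discrim_le_zero key
  rw [discrim] at hd
  by_cases h0 : ‖a‖ = 0
  · rw [h0, zero_pow two_ne_zero]; exact mul_nonneg (norm_nonneg _) (norm_nonneg _)
  · have : 0 < ‖a‖ ^ 2 := by positivity
    nlinarith

/-- The seminorm `‖x‖ = ‖⟨x, x⟩‖ ^ (1 / 2)`. -/
noncomputable instance : Norm V.carrier := ⟨fun x => √‖V.inner x x‖⟩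

theorem norm_def (x : V.carrier) : ‖x‖ = √‖V.inner x x‖ := rfl

theorem norm_sq (x : V.carrier) : ‖x‖ ^ 2 = ‖V.inner x x‖ := by
  rw [norm_def, Real.sq_sqrt (norm_nonneg _)]

theorem norm_inner_le (x y : V.carrier) : ‖V.inner x y‖ ≤ ‖x‖ * ‖y‖ := by
  refine le_of_sq_le_sq ?_ (mul_nonneg (Real.sqrt_nonneg _) (Real.sqrt_nonneg _))
  rw [mul_pow, norm_sq, norm_sq]
  exact V.norm_inner_sq_le x y

theorem seminormedSpaceCore : SeminormedSpace.Core ℂ V.carrier where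
  norm_nonneg _ := Real.sqrt_nonneg _
  norm_smul c x := by
    rw [norm_def, norm_def, V.inner_smul_left, V.inner_smul_right, smul_smul, norm_smul, norm_mul,
      norm_star, Real.sqrt_mul (by positivity), Real.sqrt_mul_self (norm_nonneg _)]
  norm_triangle x y := by
    refine le_of_sq_le_sq ?_ (add_nonneg (Real.sqrt_nonneg _) (Real.sqrt_nonneg _))
    have h1 := V.norm_inner_le x y
    have h2 := V.norm_inner_le y x
    have hx := V.norm_sq x
    have hy := V.norm_sq y
    rw [norm_sq, V.inner_add_left, V.inner_add_right, V.inner_add_right]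
    have := norm_add_le (V.inner x x + V.inner x y) (V.inner y x + V.inner y y)
    have := norm_add_le (V.inner x x) (V.inner x y)
    have := norm_add_le (V.inner y x) (V.inner y y)
    nlinarith

noncomputable instance : SeminormedAddCommGroup V.carrier :=
  SeminormedAddCommGroup.ofCore V.seminormedSpaceCore

noncomputable instance : NormedSpace ℂ V.carrier where
  norm_smul_le c x := (V.seminormedSpaceCore.norm_smul c x).le

theorem continuous_inner : Continuous fun p : V.carrier × V.carrier => V.inner p.1 p.2 := by
  let f := LinearMap.mkContinuous₂ V.innerₛₗ 1 fun x y => by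
    simpa [innerₛₗ_apply] using V.norm_inner_le x y
  exact (f.continuous.comp continuous_fst).clm_apply continuous_snd

theorem norm_left_le (a : A) (x : V.carrier) : ‖V.left a x‖ ≤ ‖a‖ * ‖x‖ := by
  let _ : PartialOrder A := CStarAlgebra.spectralOrder A
  let _ : StarOrderedRing A := CStarAlgebra.spectralOrderedRing A
  obtain ⟨c, hc⟩ := CStarAlgebra.nonneg_iff_eq_star_mul_self.1
    (sub_nonneg.2 (CStarAlgebra.star_mul_le_algebraMap_norm_sq (a := a)))
  have h1 : V.inner (V.left a x) (V.left a x) ≤ ((‖a‖ ^ 2 : ℝ) : ℂ) • V.inner x x := by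
    have h2 := V.inner_self_nonneg (V.left c x)
    rw [V.inner_left, ← Module.End.mul_apply, ← map_mul, ← hc, map_sub, LinearMap.sub_apply,
      ← innerₛₗ_apply, map_sub, IsScalarTower.algebraMap_apply ℝ ℂ A, AlgHom.commutes,
      Module.algebraMap_end_apply, map_smul, innerₛₗ_apply, innerₛₗ_apply, map_mul,
      Module.End.mul_apply, ← V.inner_left, sub_nonneg] at h2
    exact h2
  refine le_of_sq_le_sq ?_ (mul_nonneg (norm_nonneg _) (norm_nonneg _))
  rw [norm_sq, mul_pow, norm_sq]
  refine (CStarAlgebra.norm_le_norm_of_nonneg_of_le (V.inner_self_nonneg _) h1).trans ?_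
  rw [norm_smul, Complex.norm_real, Real.norm_of_nonneg (sq_nonneg _)]

theorem norm_right_le (b : B) (x : V.carrier) :
    ‖V.right (MulOpposite.op b) x‖ ≤ ‖b‖ * ‖x‖ := by
  refine le_of_sq_le_sq ?_ (mul_nonneg (norm_nonneg _) (norm_nonneg _))
  rw [norm_sq, V.inner_right, V.inner_right_left, mul_pow, norm_sq]
  calc _ ≤ ‖star b * V.inner x x‖ * ‖b‖ := norm_mul_le _ _
    _ ≤ ‖star b‖ * ‖V.inner x x‖ * ‖b‖ := by gcongr; exact norm_mul_le _ _
    _ = _ := by rw [norm_star]; ring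

/-- The left action by bounded operators. -/
noncomputable def leftL : A →ₐ[ℂ] V.carrier →L[ℂ] V.carrier :=
  AlgHom.ofLinearMap
    { toFun := fun a => (V.left a).mkContinuous ‖a‖ (V.norm_left_le a)
      map_add' := fun a b => by ext x; simp
      map_smul' := fun c a => by ext x; simp }
    (by ext x; simp) (fun a b => by ext x; simp)

/-- The right action by bounded operators. -/
noncomputable def rightL : Bᵐᵒᵖ →ₐ[ℂ] V.carrier →L[ℂ] V.carrier :=
  AlgHom.ofLinearMap
    { toFun := fun b => (V.right b).mkContinuous ‖b.unop‖ (V.norm_right_le b.unop)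
      map_add' := fun a b => by ext x; simp; rfl
      map_smul' := fun c a => by ext x; simp; rfl }
    (by ext x; simp) (fun a b => by ext x; simp; rfl)

theorem leftL_apply (a : A) (x : V.carrier) : V.leftL a x = V.left a x := rfl

theorem rightL_apply (b : Bᵐᵒᵖ) (x : V.carrier) : V.rightL b x = V.right b x := rfl

open UniformSpace (Completion)

/-- The inner product of the completion, extended by continuity. -/
noncomputable def completionInner : Completion V.carrier → Completion V.carrier → B :=
  Function.curry ((Completion.isDenseInducing_coe.prodMap Completion.isDenseInducing_coe).extend
    (Function.uncurry V.inner))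

theorem completionInner_coe (x y : V.carrier) :
    V.completionInner (x : Completion V.carrier) (y : Completion V.carrier) = V.inner x y :=
  (Completion.isDenseInducing_coe.prodMap Completion.isDenseInducing_coe).extend_eq
    V.continuous_inner (x, y)

theorem continuous_completionInner : Continuous (Function.uncurry V.completionInner) := by
  let f : V.carrier →+ V.carrier →+ B :=
    { toFun := fun x => (V.innerₛₗ x).toAddMonoidHom
      map_zero' := by ext y; simp
      map_add' := fun x y => by ext z; simp }
  have h : Continuous fun p : V.carrier × V.carrier => f p.1 p.2 := V.continuous_inner
  rw [completionInner, Function.uncurry_curry]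
  exact (Completion.isDenseInducing_toCompl V.carrier).extend_Z_bilin
    (Completion.isDenseInducing_toCompl V.carrier) h

theorem continuous_completionInner' {T : Type*} [TopologicalSpace T]
    {f g : T → Completion V.carrier} (hf : Continuous f) (hg : Continuous g) :
    Continuous fun t => V.completionInner (f t) (g t) :=
  V.continuous_completionInner.comp (hf.prodMk hg)

theorem completionInner_add_right (x y z : Completion V.carrier) :
    V.completionInner x (y + z) = V.completionInner x y + V.completionInner x z := by
  have h1 : Continuous fun p : Completion V.carrier × Completion V.carrier × Completion V.carrier =>
      p.2.1 := continuous_snd.fst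
  have h2 : Continuous fun p : Completion V.carrier × Completion V.carrier × Completion V.carrier =>
      p.2.2 := continuous_snd.snd
  refine Completion.induction_on₃ x y z
    (isClosed_eq (V.continuous_completionInner' continuous_fst (h1.add h2))
      ((V.continuous_completionInner' continuous_fst h1).add
        (V.continuous_completionInner' continuous_fst h2))) fun a b c => ?_
  rw [← Completion.coe_add, V.completionInner_coe, V.completionInner_coe,
    V.completionInner_coe, V.inner_add_right]

theorem completionInner_smul_right (c : ℂ) (x y : Completion V.carrier) :
    V.completionInner x (c • y) = c • V.completionInner x y := by
  refine Completion.induction_on₂ x y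
    (isClosed_eq (V.continuous_completionInner' continuous_fst (continuous_snd.const_smul c))
      ((V.continuous_completionInner' continuous_fst continuous_snd).const_smul c)) fun a b => ?_
  rw [← Completion.coe_smul, V.completionInner_coe, V.completionInner_coe, V.inner_smul_right]

theorem star_completionInner (x y : Completion V.carrier) :
    star (V.completionInner x y) = V.completionInner y x := by
  refine Completion.induction_on₂ x y
    (isClosed_eq (V.continuous_completionInner' continuous_fst continuous_snd).star
      (V.continuous_completionInner' continuous_snd continuous_fst)) fun a b => ?_
  rw [V.completionInner_coe, V.completionInner_coe, V.star_inner]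

theorem completionInner_self_nonneg (x : Completion V.carrier) : 0 ≤ V.completionInner x x := by
  refine Completion.induction_on x (CStarAlgebra.isClosed_nonneg.preimage
    (V.continuous_completionInner' continuous_id continuous_id)) fun a => ?_
  rw [V.completionInner_coe]
  exact V.inner_self_nonneg a

theorem completionInner_rightL (x y : Completion V.carrier) (b : Bᵐᵒᵖ) :
    V.completionInner x ((V.rightL b).completion y) = V.completionInner x y * b.unop := by
  refine Completion.induction_on₂ x y
    (isClosed_eq (V.continuous_completionInner' continuous_fst
        ((V.rightL b).completion.continuous.comp continuous_snd))
      ((V.continuous_completionInner' continuous_fst continuous_snd).mul continuous_const))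
    fun x y => ?_
  rw [ContinuousLinearMap.completion_apply_coe, V.completionInner_coe, V.completionInner_coe,
    rightL_apply, ← V.inner_right, MulOpposite.op_unop]

theorem completionInner_leftL (a : A) (x y : Completion V.carrier) :
    V.completionInner ((V.leftL a).completion x) y
      = V.completionInner x ((V.leftL (star a)).completion y) := by
  refine Completion.induction_on₂ x y
    (isClosed_eq (V.continuous_completionInner'
        ((V.leftL a).completion.continuous.comp continuous_fst) continuous_snd)
      (V.continuous_completionInner' continuous_fst
        ((V.leftL (star a)).completion.continuous.comp continuous_snd))) fun x y => ?_
  rw [ContinuousLinearMap.completion_apply_coe, ContinuousLinearMap.completion_apply_coe,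
    V.completionInner_coe, V.completionInner_coe, leftL_apply, leftL_apply, V.inner_left]

theorem norm_completion (x : Completion V.carrier) : ‖x‖ = √‖V.completionInner x x‖ := by
  refine Completion.induction_on x (isClosed_eq continuous_norm
    (Real.continuous_sqrt.comp
      (V.continuous_completionInner' continuous_id continuous_id).norm)) fun a => ?_
  rw [Completion.norm_coe, V.completionInner_coe, norm_def]

/-- The C⋆-correspondence obtained from a pre-correspondence by dividing out the vectors of length
zero and completing (`UniformSpace.Completion` does both). -/
noncomputable def completion : Correspondence A B where
  carrier := Completion V.carrier
  left := (completionEnd V.carrier).comp V.leftL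
  right := (completionEnd V.carrier).comp V.rightL
  inner := V.completionInner
  inner_add_right := V.completionInner_add_right
  inner_smul_right := V.completionInner_smul_right
  star_inner := V.star_completionInner
  inner_self_nonneg := V.completionInner_self_nonneg
  inner_right x y b := V.completionInner_rightL x y (MulOpposite.op b)
  inner_left := V.completionInner_leftL
  norm_eq := V.norm_completion

end PreCorrespondence

section Positivity

variable {B : Type u} [CStarAlgebra B] [PartialOrder B] [StarOrderedRing B]

theorem exists_star_mul_self_of_nonneg {a : B} (ha : 0 ≤ a) : ∃ r, a = star r * r :=
  CStarAlgebra.nonneg_iff_eq_star_mul_self.1 ha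

/-- A self-adjoint element `a` is positive if the compression `star c * a * c` by a suitable element
(its negative part) is not strictly negative. -/
theorem exists_compression {a : B} (ha : star a = a) :
    ∃ c r : B, star c * a * c = -(star r * r) ∧ (r = 0 → 0 ≤ a) := by
  have hneg : star a⁻ = a⁻ := (CFC.negPart_nonneg a).isSelfAdjoint
  obtain ⟨r, hr⟩ := CStarAlgebra.nonneg_iff_eq_star_mul_self.1
    (star_left_conjugate_nonneg (CFC.negPart_nonneg a) a⁻)
  refine ⟨a⁻, r, ?_, fun h => ?_⟩
  · rw [← hr, hneg]
    nth_rw 2 [← CFC.posPart_sub_negPart a ha]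
    rw [mul_sub, CFC.negPart_mul_posPart]
    noncomm_ring
  · rw [h, mul_zero, hneg] at hr
    have h8 : (a⁻ * a⁻) * (a⁻ * a⁻) = 0 := by
      rw [← mul_assoc, hr, zero_mul]
    have h9 : a⁻ * a⁻ = 0 := by
      rw [← CStarRing.star_mul_self_eq_zero_iff, star_mul, hneg, h8]
    have h7 : a⁻ = 0 := by
      rw [← CStarRing.star_mul_self_eq_zero_iff, hneg, h9]
    rw [← CFC.posPart_sub_negPart a ha, h7, sub_zero]
    exact CFC.posPart_nonneg a

/-- A positive matrix is a finite sum of matrices `(star (r i) * r j)`. -/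
theorem CStarMatrix.exists_of_nonneg {k : ℕ} {M : CStarMatrix (Fin k) (Fin k) B} (hM : 0 ≤ M) :
    ∃ R : Fin k → Fin k → B, ∀ i j, M i j = ∑ l, star (R l i) * R l j := by
  obtain ⟨R, rfl⟩ := exists_star_mul_self_of_nonneg (B := CStarMatrix (Fin k) (Fin k) B) hM
  exact ⟨R, fun i j => rfl⟩

/-- A self-adjoint matrix whose quadratic form is positive is positive. -/
theorem CStarMatrix.nonneg_of_form_nonneg {k : ℕ} {M : CStarMatrix (Fin k) (Fin k) B}
    (hsa : star M = M) (hM : ∀ v : Fin k → B, 0 ≤ ∑ i, ∑ j, star (v i) * M i j * v j) :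
    0 ≤ M := by
  obtain ⟨N, R, h1, h2⟩ := exists_compression (B := CStarMatrix (Fin k) (Fin k) B) hsa
  refine h2 ?_
  ext l i
  have h3 : ∑ q, (∑ p, star (N p i) * M p q) * N q i = -∑ l, star (R l i) * R l i :=
    congrFun (congrFun h1 i) i
  have h4 := hM (fun j => N j i)
  rw [Finset.sum_comm] at h4
  simp only [← Finset.sum_mul] at h4
  rw [h3] at h4
  have h5 : ∑ l, star (R l i) * R l i = 0 :=
    le_antisymm (neg_nonneg.1 h4) (Finset.sum_nonneg fun _ _ => star_mul_self_nonneg _)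
  have h6 := (Finset.sum_eq_zero_iff_of_nonneg fun _ _ => star_mul_self_nonneg _).1 h5 l
    (Finset.mem_univ l)
  exact CStarRing.star_mul_self_eq_zero_iff _ |>.1 h6

end Positivity

section TensorForm

variable {V W : Type u} [AddCommGroup V] [Module ℂ V] [AddCommGroup W] [Module ℂ W]

theorem exists_fin_tensor (t : V ⊗[ℂ] W) :
    ∃ (k : ℕ) (v : Fin k → V) (w : Fin k → W), t = ∑ i, v i ⊗ₜ[ℂ] w i := by
  obtain ⟨S, rfl⟩ := TensorProduct.exists_finset t
  refine ⟨S.card, fun i => (S.equivFin.symm i).1.1, fun i => (S.equivFin.symm i).1.2, ?_⟩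
  rw [← Finset.sum_coe_sort]
  exact (Equiv.sum_comp S.equivFin.symm fun s : S => s.1.1 ⊗ₜ[ℂ] s.1.2).symm

variable {C : Type u} [CStarAlgebra C]

/-- Data for a semi-inner product on `V ⊗ W`: a function `form v w v' w'`, additive and homogeneous
in the last two variables, hermitian symmetric, and positive on finite families. -/
structure TensorForm (V W C : Type u) [AddCommGroup V] [Module ℂ V] [AddCommGroup W] [Module ℂ W]
    [CStarAlgebra C] [PartialOrder C] where
  /-- the value `⟨v ⊗ w, v' ⊗ w'⟩` -/
  form : V → W → V → W → C
  add_three : ∀ v w x y z, form v w (x + y) z = form v w x z + form v w y z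
  smul_three : ∀ v w (c : ℂ) x z, form v w (c • x) z = c • form v w x z
  add_four : ∀ v w x y z, form v w x (y + z) = form v w x y + form v w x z
  smul_four : ∀ v w (c : ℂ) x z, form v w x (c • z) = c • form v w x z
  star_form : ∀ v w x y, star (form v w x y) = form x y v w
  nonneg : ∀ (k : ℕ) (v : Fin k → V) (w : Fin k → W), 0 ≤ ∑ i, ∑ j, form (v i) (w i) (v j) (w j)

namespace TensorForm

variable [PartialOrder C] (F : TensorForm V W C)

/-- The functional `⟨v ⊗ w, ·⟩` on the tensor product. -/
noncomputable def right (v : V) (w : W) : V ⊗[ℂ] W →ₗ[ℂ] C :=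
  TensorProduct.lift (LinearMap.mk₂ ℂ (F.form v w) (fun x y z => F.add_three v w x y z)
    (fun c x z => F.smul_three v w c x z) (fun x y z => F.add_four v w x y z)
    (fun c x z => F.smul_four v w c x z))

theorem right_tmul (v x : V) (w y : W) : F.right v w (x ⊗ₜ y) = F.form v w x y := rfl

theorem add_one (v v' : V) (w : W) (x : V) (y : W) :
    F.form (v + v') w x y = F.form v w x y + F.form v' w x y := by
  rw [← F.star_form, F.add_three, star_add, F.star_form, F.star_form]

theorem add_two (v : V) (w w' : W) (x : V) (y : W) :
    F.form v (w + w') x y = F.form v w x y + F.form v w' x y := by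
  rw [← F.star_form, F.add_four, star_add, F.star_form, F.star_form]

theorem smul_one (c : ℂ) (v : V) (w : W) (x : V) (y : W) :
    F.form (c • v) w x y = star c • F.form v w x y := by
  rw [← F.star_form, F.smul_three, star_smul, F.star_form]

theorem smul_two (c : ℂ) (v : V) (w : W) (x : V) (y : W) :
    F.form v (c • w) x y = star c • F.form v w x y := by
  rw [← F.star_form, F.smul_four, star_smul, F.star_form]

/-- The sesquilinear form on `V ⊗ W` with `⟨v ⊗ w, v' ⊗ w'⟩ = form v w v' w'`. -/
noncomputable def sesq : V ⊗[ℂ] W →ₗ⋆[ℂ] V ⊗[ℂ] W →ₗ[ℂ] C :=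
  TensorProduct.lift (LinearMap.mk₂'ₛₗ (starRingEnd ℂ) (starRingEnd ℂ) F.right
    (fun v v' w => TensorProduct.ext' fun x y => F.add_one v v' w x y)
    (fun c v w => TensorProduct.ext' fun x y => F.smul_one c v w x y)
    (fun v w w' => TensorProduct.ext' fun x y => F.add_two v w w' x y)
    (fun c v w => TensorProduct.ext' fun x y => F.smul_two c v w x y))

theorem sesq_tmul (v x : V) (w y : W) : F.sesq (v ⊗ₜ w) (x ⊗ₜ y) = F.form v w x y := rfl

theorem star_sesq (s t : V ⊗[ℂ] W) : star (F.sesq s t) = F.sesq t s := by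
  induction s with
  | zero => simp
  | add s s' h h' => simp [h, h']
  | tmul v w =>
    induction t with
    | zero => simp
    | add t t' h h' => simp [h, h']
    | tmul x y => exact F.star_form v w x y

theorem sesq_self_nonneg (t : V ⊗[ℂ] W) : 0 ≤ F.sesq t t := by
  obtain ⟨k, v, w, rfl⟩ := exists_fin_tensor t
  simp only [map_sum, LinearMap.sum_apply, sesq_tmul]
  rw [Finset.sum_comm]
  exact F.nonneg k v w

/-- The pre-correspondence on `V ⊗ W` with semi-inner product `form`, with left action on the first
and right action on the second tensor factor. -/
noncomputable def preCorrespondence [StarOrderedRing C] {A : Type u} [CStarAlgebra A] (left : A →ₐ[ℂ] Module.End ℂ V)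
    (right : Cᵐᵒᵖ →ₐ[ℂ] Module.End ℂ W)
    (form_left : ∀ a v w x y, F.form (left a v) w x y = F.form v w (left (star a) x) y)
    (form_right : ∀ v w x y c,
      F.form v w x (right (MulOpposite.op c) y) = F.form v w x y * c) :
    PreCorrespondence A C where
  carrier := V ⊗[ℂ] W
  left := (Module.End.rTensorAlgHom ℂ V W).comp left
  right := (Module.End.lTensorAlgHom ℂ W V).comp right
  inner s t := F.sesq s t
  inner_add_right s t t' := map_add _ _ _
  inner_smul_right c s t := map_smul _ _ _
  star_inner := F.star_sesq
  inner_self_nonneg := F.sesq_self_nonneg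
  inner_right s t c := by
    induction s with
    | zero => simp
    | add s s' h h' => simp only [map_add, LinearMap.add_apply, h, h', add_mul]
    | tmul v w =>
      induction t with
      | zero => simp
      | add t t' h h' => simp only [map_add, h, h', add_mul]
      | tmul x y => exact form_right v w x y c
  inner_left a s t := by
    induction s with
    | zero => simp
    | add s s' h h' => simp only [map_add, LinearMap.add_apply, h, h']
    | tmul v w =>
      induction t with
      | zero => simp
      | add t t' h h' => simp only [map_add, h, h']
      | tmul x y => exact form_left a v w x y

end TensorForm

end TensorForm

theorem sum_sum_star_mul {B : Type u} [CStarAlgebra B] {k : ℕ} (x : Fin k → B) :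
    ∑ i, ∑ j, star (x i) * x j = star (∑ i, x i) * ∑ i, x i := by
  rw [star_sum, Finset.sum_mul_sum]

theorem sum_sum_sum_comm {B : Type u} [AddCommMonoid B] {k : ℕ} (f : Fin k → Fin k → Fin k → B) :
    ∑ i, ∑ j, ∑ l, f i j l = ∑ l, ∑ i, ∑ j, f i j l := by
  rw [Finset.sum_comm (f := fun l i => ∑ j, f i j l)]
  exact Finset.sum_congr rfl fun i _ => Finset.sum_comm

section GNS

variable {A B : Type u} [CStarAlgebra A] [PartialOrder A] [StarOrderedRing A]
  [CStarAlgebra B] [PartialOrder B] [StarOrderedRing B]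

/-- The form `⟨a₁ ⊗ b₁, a₂ ⊗ b₂⟩ = b₁⋆ P(a₁⋆ a₂) b₂` of a completely positive map `P`. -/
noncomputable def gnsForm (P : A →CP B) : TensorForm A B B where
  form a b a' b' := star b * P (star a * a') * b'
  add_three v w x y z := by simp only [mul_add, map_add, add_mul]
  smul_three v w c x z := by simp
  add_four v w x y z := by simp only [mul_add]
  smul_four v w c x z := by simp
  star_form v w x y := by
    have h : star (P (star v * x)) = P (star x * v) := by
      rw [← map_star P, star_mul, star_star]
    rw [star_mul, star_mul, star_star, h, mul_assoc]
  nonneg k v w := by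
    have h0 : 0 ≤ (CStarMatrix.ofMatrix fun i j => star (v i) * v j :
        CStarMatrix (Fin k) (Fin k) A) := by
      refine CStarMatrix.nonneg_of_form_nonneg ?_ fun u => ?_
      · ext i j
        change star (star (v j) * v i) = star (v i) * v j
        rw [star_mul, star_star]
      · have h := star_mul_self_nonneg (∑ i, v i * u i)
        rw [← sum_sum_star_mul] at h
        change 0 ≤ ∑ i, ∑ j, star (u i) * (star (v i) * v j) * u j
        simpa only [star_mul, mul_assoc] using h
    obtain ⟨R, hR⟩ := CStarMatrix.exists_of_nonneg (P.map_cstarMatrix_nonneg' k _ h0)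
    have h1 : ∀ i j, star (w i) * P (star (v i) * v j) * w j
        = ∑ l, star (R l i * w i) * (R l j * w j) := by
      intro i j
      have : P (star (v i) * v j) = ∑ l, star (R l i) * R l j := hR i j
      rw [this, Finset.mul_sum, Finset.sum_mul]
      exact Finset.sum_congr rfl fun l _ => by rw [star_mul]; simp only [mul_assoc]
    have h2 : ∑ i, ∑ j, star (w i) * P (star (v i) * v j) * w j
        = ∑ l, star (∑ i, R l i * w i) * ∑ i, R l i * w i := by
      simp only [h1, ← sum_sum_star_mul]
      exact sum_sum_sum_comm _
    rw [h2]
    exact Finset.sum_nonneg fun _ _ => star_mul_self_nonneg _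

/-- The algebraic tensor product of `A` and `B` with the semi-inner product
`⟨a₁ ⊗ b₁, a₂ ⊗ b₂⟩ = b₁⋆ P(a₁⋆ a₂) b₂`, with `A` acting by left multiplication on the first and
`B` by right multiplication on the second factor. -/
noncomputable def gnsPreCorrespondence (P : A →CP B) : PreCorrespondence A B :=
  (gnsForm P).preCorrespondence (Algebra.lsmul ℂ ℂ A) (Algebra.lsmul ℂ ℂ B)
    (fun a v w x y => by
      change star w * P (star (a * v) * x) * y = star w * P (star v * (star a * x)) * y
      rw [star_mul, mul_assoc (star v)])
    (fun v w x y c => by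
      change star w * P (star v * x) * (y * c) = star w * P (star v * x) * y * c
      rw [← mul_assoc])

/-- The GNS correspondence `A ⊗_P B` of a completely positive map `P : A → B`: the algebraic tensor
product of `A` and `B` with `⟨a₁ ⊗ b₁, a₂ ⊗ b₂⟩ = b₁⋆ P(a₁⋆ a₂) b₂`, divided by the vectors of
length zero and completed. (When `A` and `B` are finite dimensional, the completion adds nothing to
the quotient.) -/
noncomputable def gnsCorrespondence (P : A →CP B) : Correspondence A B :=
  (gnsPreCorrespondence P).completion

end GNS

namespace Correspondence

section Tensor

variable {A B C : Type u} [CStarAlgebra A] [CStarAlgebra B] [PartialOrder B] [StarOrderedRing B]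
  [CStarAlgebra C] [PartialOrder C] [StarOrderedRing C]

theorem inner_add_left (E : Correspondence A B) (x y z : E.carrier) :
    E.inner (x + y) z = E.inner x z + E.inner y z := by
  rw [← E.star_inner z, E.inner_add_right, star_add, E.star_inner, E.star_inner]

theorem inner_smul_left (E : Correspondence A B) (c : ℂ) (x y : E.carrier) :
    E.inner (c • x) y = star c • E.inner x y := by
  rw [← E.star_inner y, E.inner_smul_right, star_smul, E.star_inner]

theorem inner_right_left (E : Correspondence A B) (x y : E.carrier) (b : B) :
    E.inner (E.right (MulOpposite.op b) x) y = star b * E.inner x y := by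
  rw [← E.star_inner y, E.inner_right, star_mul, E.star_inner]

/-- The inner product as a sesquilinear map. -/
noncomputable def innerₛₗ (E : Correspondence A B) : E.carrier →ₗ⋆[ℂ] E.carrier →ₗ[ℂ] B :=
  LinearMap.mk₂'ₛₗ _ _ E.inner E.inner_add_left E.inner_smul_left E.inner_add_right
    E.inner_smul_right

theorem innerₛₗ_apply (E : Correspondence A B) (x y : E.carrier) :
    E.innerₛₗ x y = E.inner x y := rfl

theorem inner_sum_sum (E : Correspondence A B) {k : ℕ} (x y : Fin k → E.carrier) :
    E.inner (∑ i, x i) (∑ j, y j) = ∑ i, ∑ j, E.inner (x i) (y j) := by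
  simp only [← innerₛₗ_apply, map_sum, LinearMap.sum_apply]
  rw [Finset.sum_comm]

/-- The form `⟨e₁ ⊗ x₁, e₂ ⊗ x₂⟩ = ⟨x₁, ⟨e₁, e₂⟩ · x₂⟩`. -/
noncomputable def tensorForm (E : Correspondence A B) (X : Correspondence B C) :
    TensorForm E.carrier X.carrier C where
  form e x e' x' := X.inner x (X.left (E.inner e e') x')
  add_three v w x y z := by
    rw [E.inner_add_right, map_add, LinearMap.add_apply, X.inner_add_right]
  smul_three v w c x z := by
    rw [E.inner_smul_right, map_smul, LinearMap.smul_apply, X.inner_smul_right]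
  add_four v w x y z := by rw [map_add, X.inner_add_right]
  smul_four v w c x z := by rw [map_smul, X.inner_smul_right]
  star_form v w x y := by rw [X.star_inner, X.inner_left, E.star_inner]
  nonneg k v w := by
    have h0 : 0 ≤ (CStarMatrix.ofMatrix fun i j => E.inner (v i) (v j) :
        CStarMatrix (Fin k) (Fin k) B) := by
      refine CStarMatrix.nonneg_of_form_nonneg ?_ fun u => ?_
      · ext i j
        exact E.star_inner _ _
      · have h := E.inner_self_nonneg (∑ i, E.right (MulOpposite.op (u i)) (v i))
        rw [E.inner_sum_sum] at h
        change 0 ≤ ∑ i, ∑ j, star (u i) * E.inner (v i) (v j) * u j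
        simpa only [E.inner_right, E.inner_right_left] using h
    obtain ⟨R, hR⟩ := CStarMatrix.exists_of_nonneg h0
    have h1 : ∀ i j, X.inner (w i) (X.left (E.inner (v i) (v j)) (w j))
        = ∑ l, X.inner (X.left (R l i) (w i)) (X.left (R l j) (w j)) := by
      intro i j
      have : E.inner (v i) (v j) = ∑ l, star (R l i) * R l j := hR i j
      rw [this, map_sum, LinearMap.sum_apply, ← innerₛₗ_apply, map_sum]
      exact Finset.sum_congr rfl fun l _ => by
        rw [X.inner_left, map_mul, Module.End.mul_apply, innerₛₗ_apply]
    simp only [h1]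
    rw [sum_sum_sum_comm]
    simp only [← X.inner_sum_sum]
    exact Finset.sum_nonneg fun _ _ => X.inner_self_nonneg _

/-- The algebraic tensor product of `E` and `X` with the semi-inner product
`⟨e₁ ⊗ x₁, e₂ ⊗ x₂⟩ = ⟨x₁, ⟨e₁, e₂⟩ · x₂⟩`. -/
noncomputable def preTensor (E : Correspondence A B) (X : Correspondence B C) :
    PreCorrespondence A C :=
  (tensorForm E X).preCorrespondence E.left X.right
    (fun a v w x y => by
      change X.inner w (X.left (E.inner (E.left a v) x) y)
        = X.inner w (X.left (E.inner v (E.left (star a) x)) y)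
      rw [E.inner_left])
    (fun v w x y c => by
      change X.inner w (X.left (E.inner v x) (X.right (MulOpposite.op c) y))
        = X.inner w (X.left (E.inner v x) y) * c
      rw [← E.star_inner x, ← X.inner_left, X.inner_right, X.inner_left])

/-- The interior tensor product `E ⊗_B X`: the completion of the algebraic tensor product, modulo
the vectors of length zero, in the inner product
`⟨e₁ ⊗ x₁, e₂ ⊗ x₂⟩ = ⟨x₁, ⟨e₁, e₂⟩ · x₂⟩`. (The elements `(e · b) ⊗ x - e ⊗ (b · x)` have length
zero, so the tensor product is balanced over `B`.) -/
noncomputable def tensor (E : Correspondence A B) (X : Correspondence B C) : Correspondence A C :=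
  (preTensor E X).completion

end Tensor

/-- An isomorphism of C⋆-correspondences: a linear bijection which is a bimodule map and preserves
the inner products. -/
structure Iso {A B : Type u} [CStarAlgebra A] [CStarAlgebra B] [PartialOrder B] [StarOrderedRing B]
    (E F : Correspondence A B) extends E.carrier ≃ₗ[ℂ] F.carrier where
  map_left : ∀ a x, toFun (E.left a x) = F.left a (toFun x)
  map_right : ∀ b x, toFun (E.right b x) = F.right b (toFun x)
  map_inner : ∀ x y, F.inner (toFun x) (toFun y) = E.inner x y

end Correspondence

/-- A Hilbert space as a C⋆-correspondence over `ℂ`, with both actions given by scalar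
multiplication. -/
noncomputable def hilbertSpaceCorrespondence (H : Type) [NormedAddCommGroup H] [InnerProductSpace ℂ H]
    [CompleteSpace H] : Correspondence ℂ ℂ where
  carrier := H
  left := Algebra.lsmul ℂ ℂ H
  right := (Algebra.lsmul ℂ ℂ H).comp (AlgEquiv.toOpposite ℂ ℂ).symm.toAlgHom
  inner x y := inner ℂ x y
  inner_add_right := inner_add_right
  inner_smul_right c x y := inner_smul_right x y c
  star_inner x y := inner_conj_symm y x
  inner_self_nonneg x := by
    rw [inner_self_eq_norm_sq_to_K]
    exact pow_nonneg (Complex.zero_le_real.2 (norm_nonneg x)) 2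
  inner_right x y b := by
    rw [mul_comm]
    exact inner_smul_right x y b
  inner_left a x y := by
    change inner ℂ (a • x) y = inner ℂ x (star a • y)
    rw [inner_smul_left, inner_smul_right]
    rfl
  norm_eq x := by
    rw [inner_self_eq_norm_sq_to_K]
    simp

/-- An `A`-`B` *equivalence bimodule* (imprimitivity bimodule): a C⋆-correspondence from `A` to `B`
which is also a left Hilbert C⋆-module over `A`, such that both inner products are full, `B` acts by
adjointable operators for the `A`-valued inner product, and `⟨x, y⟩_A · z = x · ⟨y, z⟩_B`. -/
structure EquivalenceBimodule (A B : Type u) [CStarAlgebra A] [PartialOrder A] [StarOrderedRing A]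
    [CStarAlgebra B] [PartialOrder B] [StarOrderedRing B] extends Correspondence A B where
  /-- the `A`-valued inner product, linear in the first variable -/
  leftInner : carrier → carrier → A
  leftInner_add_left : ∀ x y z, leftInner (x + y) z = leftInner x z + leftInner y z
  leftInner_smul_left : ∀ (c : ℂ) x y, leftInner (c • x) y = c • leftInner x y
  star_leftInner : ∀ x y, star (leftInner x y) = leftInner y x
  leftInner_self_nonneg : ∀ x, 0 ≤ leftInner x x
  leftInner_left : ∀ a x y, leftInner (left a x) y = a * leftInner x y
  leftInner_right : ∀ b x y, leftInner (right (MulOpposite.op b) x) y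
    = leftInner x (right (MulOpposite.op (star b)) y)
  norm_eq_left : ∀ x, ‖x‖ = √‖leftInner x x‖
  left_leftInner : ∀ x y z, left (leftInner x y) z = right (MulOpposite.op (inner y z)) x
  full_left : Dense (Submodule.span ℂ (Set.range fun p : carrier × carrier => leftInner p.1 p.2) :
    Set A)
  full_right : Dense (Submodule.span ℂ (Set.range fun p : carrier × carrier => inner p.1 p.2) :
    Set B)

/-- *Strong Morita equivalence* of a C⋆-correspondence `E` over `A` and a C⋆-correspondence `F` over
`B`: there are an `A`-`B` equivalence bimodule `X` and an isomorphism of correspondences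
`E ⊗_A X ≅ X ⊗_B F`. -/
def StronglyMoritaEquivalent {A B : Type u} [CStarAlgebra A] [PartialOrder A] [StarOrderedRing A]
    [CStarAlgebra B] [PartialOrder B] [StarOrderedRing B]
    (E : Correspondence A A) (F : Correspondence B B) : Prop :=
  ∃ X : EquivalenceBimodule A B,
    Nonempty ((E.tensor X.toCorrespondence).Iso (X.toCorrespondence.tensor F))

/-- `P(a) = ∑ r, t r * a * (t r)⋆`. -/
def IsKrausFamily {n N : ℕ} (P : Matrix (Fin n) (Fin n) ℂ →CP Matrix (Fin n) (Fin n) ℂ)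
    (t : Fin N → Matrix (Fin n) (Fin n) ℂ) : Prop :=
  ∀ a, P a = ∑ r, t r * a * star (t r)

/-- The index `d(P)` of a completely positive map `P`: the dimension of the linear span of the
operators `t r` in a representation `P(a) = ∑ r, t r * a * (t r)⋆`. (All such representations give
the same dimension; the infimum merely selects it.) -/
noncomputable def krausIndex {n : ℕ} (P : Matrix (Fin n) (Fin n) ℂ →CP Matrix (Fin n) (Fin n) ℂ) :
    ℕ :=
  sInf {d | ∃ (N : ℕ) (t : Fin N → Matrix (Fin n) (Fin n) ℂ),
    IsKrausFamily P t ∧ Module.finrank ℂ (Submodule.span ℂ (Set.range t)) = d}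

/-! The Choi matrix of `P` carries the first two claims. Stack the entries of each `t r` into a
column and let `S` be the matrix with these columns. Since the matrix units span, `P(a) = ∑ r, t r *
a * (t r)⋆` says exactly that the Choi matrix equals `S * Sᴴ` (`isKrausFamily_iff`). Complete
positivity makes the Choi matrix positive semidefinite, so such an `S` exists. The rank of `S * Sᴴ`
is that of `S`, so the span of the `t r` has dimension equal to the rank of the Choi matrix,
whatever the representation. The spectral theorem gives an `S` with exactly that many columns, hence
a linearly independent family `t`.

For the Morita equivalence take for `X` the column space `ℂⁿ`, an equivalence bimodule between
`Mₙ(ℂ)` and `ℂ`. With an independent family of `d` operators, the intertwiner is `(a ⊗ b) ⊗ x ↦ ∑ r,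
(a (t r)⋆ b x) ⊗ e_r`. It preserves inner products, because `∑ r, ⟨a (t r)⋆ b x, a' (t r)⋆ b' x'⟩ =
⟨x, b⋆ P(a⋆ a') b' x'⟩`. It is onto, because a vector `c` orthogonal to everything reached in the
second factor satisfies `∑ r, c r • t r = 0`. To avoid checking well-definedness on quotients, both
interior tensor products are presented as images of `Mₙ ⊗ Mₙ ⊗ ℂⁿ`: two surjections that pull back
the same form have the same kernel (`nonempty_iso_of_surjective`). In finite dimension completing
adds nothing to the quotient, which makes these maps surjective. -/

/-! ### Factorization of positive semidefinite matrices -/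

open Matrix in
/-- A positive semidefinite matrix of rank `d` factors as `S * Sᴴ` with `S` having `d` columns. -/
theorem Matrix.PosSemidef.exists_eq_mul_conjTranspose {m : Type*} [Fintype m] [DecidableEq m]
    {C : Matrix m m ℂ} (hC : C.PosSemidef) : ∃ S : Matrix m (Fin C.rank) ℂ, C = S * Sᴴ := by
  set lam := hC.isHermitian.eigenvalues with hlam
  -- The rank counts the nonzero eigenvalues; only their eigenvectors, scaled by `√λ`, become
  -- columns of `S`.
  let e : {i // lam i ≠ 0} ≃ Fin C.rank :=
    Fintype.equivFinOfCardEq hC.isHermitian.rank_eq_card_non_zero_eigs.symm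
  let U : Matrix m m ℂ := hC.isHermitian.eigenvectorUnitary
  refine ⟨Matrix.of fun p r => U p (e.symm r) * (√(lam (e.symm r)) : ℂ), ?_⟩
  ext p q
  have h1 : C p q = ∑ k, U p k * (lam k : ℂ) * star (U q k) := by
    conv_lhs => rw [hC.isHermitian.spectral_theorem]
    simp [Unitary.conjStarAlgAut_apply, Matrix.mul_apply, Matrix.diagonal_apply, U, hlam]
  rw [h1, Matrix.mul_apply, ← e.sum_comp]
  simp only [Matrix.of_apply, Matrix.conjTranspose_apply, Equiv.symm_apply_apply]
  have h2 : ∀ k, U p k * (√(lam k) : ℂ) * star (U q k * (√(lam k) : ℂ))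
      = U p k * (lam k : ℂ) * star (U q k) := by
    intro k
    have h3 : (√(lam k) : ℂ) * (√(lam k) : ℂ) = lam k := by
      rw [← Complex.ofReal_mul, Real.mul_self_sqrt (hC.eigenvalues_nonneg k)]
    rw [star_mul', Complex.star_def, Complex.conj_ofReal, ← h3]
    ring
  simp only [h2]
  set F : m → ℂ := fun k => U p k * (lam k : ℂ) * star (U q k) with hF
  -- Zero eigenvalues contribute nothing to the spectral sum, so it may be restricted to the nonzero
  -- ones.
  have h4 : ∀ k ∈ Finset.univ, F k ≠ 0 → lam k ≠ 0 := fun k _ hk h0 => hk (by simp [hF, h0])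
  exact (Finset.sum_filter_of_ne h4).symm.trans
    (Finset.sum_subtype (p := fun k => lam k ≠ 0) _ (by simp) F)

/-! ### Kraus representations and the Choi matrix -/

section Kraus

open Matrix

variable {n N : ℕ} (P : Matrix (Fin n) (Fin n) ℂ →CP Matrix (Fin n) (Fin n) ℂ)

/-- The Choi matrix of `P`, with entries `P(e_{ij})_{pq}` at `((p, i), (q, j))`. -/
noncomputable def choiMatrix : Matrix (Fin n × Fin n) (Fin n × Fin n) ℂ :=
  Matrix.of fun x y => P (Matrix.single x.2 y.2 1) x.1 y.1

/-- The matrix with the entries of the `t r` as columns. -/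
def krausMatrix (t : Fin N → Matrix (Fin n) (Fin n) ℂ) : Matrix (Fin n × Fin n) (Fin N) ℂ :=
  Matrix.of fun x r => t r x.1 x.2

variable {P}

/-- The `(p, q)` entry of `t * e_{ij} * t⋆` is `t_{pi}` times the conjugate of `t_{qj}`, so the
matrix equation is the Kraus formula tested on matrix units; linearity extends it to all `a`. -/
theorem isKrausFamily_iff {t : Fin N → Matrix (Fin n) (Fin n) ℂ} :
    IsKrausFamily P t ↔ choiMatrix P = krausMatrix t * (krausMatrix t)ᴴ := by
  constructor
  · intro h
    ext ⟨p, i⟩ ⟨q, j⟩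
    simp only [choiMatrix, Matrix.of_apply]
    rw [h]
    simp [krausMatrix, Matrix.sum_apply, Matrix.mul_apply,
      Matrix.star_eq_conjTranspose, Matrix.single_apply, ite_and]
  · intro h a
    have h1 : ∀ i j, P (Matrix.single i j 1) = ∑ r, t r * Matrix.single i j 1 * star (t r) := by
      intro i j
      ext p q
      have := congrFun (congrFun h (p, i)) (q, j)
      simp only [choiMatrix, Matrix.of_apply] at this
      rw [this]
      simp [krausMatrix, Matrix.sum_apply, Matrix.mul_apply,
        Matrix.star_eq_conjTranspose, Matrix.single_apply, ite_and]
    conv_lhs => rw [Matrix.matrix_eq_sum_single a]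
    conv_rhs => rw [Matrix.matrix_eq_sum_single a]
    have h2 : ∀ i j, Matrix.single i j (a i j) = a i j • Matrix.single i j (1 : ℂ) := by
      intro i j; simp
    simp only [h2, map_sum, map_smul, h1, Finset.mul_sum, Finset.sum_mul, Finset.smul_sum,
      Matrix.mul_smul, Matrix.smul_mul]
    rw [Finset.sum_comm (s := Finset.univ (α := Fin N))]
    refine Finset.sum_congr rfl fun i _ => ?_
    rw [Finset.sum_comm]

/-- `S * Sᴴ` and `S` have the same rank, and the columns of `S` are the `t r` read as vectors. The
right-hand side depends on `P` alone, which is why the index is well defined. -/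
theorem finrank_span_eq_rank_choiMatrix {t : Fin N → Matrix (Fin n) (Fin n) ℂ}
    (h : IsKrausFamily P t) :
    Module.finrank ℂ (Submodule.span ℂ (Set.range t)) = (choiMatrix P).rank := by
  rw [isKrausFamily_iff.1 h, Matrix.rank_self_mul_conjTranspose, Matrix.rank_eq_finrank_span_cols]
  let e : Matrix (Fin n) (Fin n) ℂ ≃ₗ[ℂ] (Fin n × Fin n → ℂ) := (LinearEquiv.curry ℂ ℂ _ _).symm
  have : Set.range (krausMatrix t).col = e.toLinearMap '' Set.range t := by
    rw [← Set.range_comp]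
    rfl
  rw [this, Submodule.span_image]
  exact (LinearEquiv.finrank_map_eq e _).symm

/-- Complete positivity is used here, on the block matrix of matrix units `(e_{ij})`. That matrix is
positive because `e_{ij} = e_{0i}⋆ * e_{0j}`; the row index `0` exists since `n ≥ 1`. -/
theorem exists_single_eq_sum (hn : 1 ≤ n) : ∃ R : Fin n → Fin n → Matrix (Fin n) (Fin n) ℂ,
    ∀ i j, P (Matrix.single i j 1) = ∑ l, star (R l i) * R l j := by
  have h0 : 0 ≤ (CStarMatrix.ofMatrix fun i j => Matrix.single i j 1 :
      CStarMatrix (Fin n) (Fin n) (Matrix (Fin n) (Fin n) ℂ)) := by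
    let v : Fin n → Matrix (Fin n) (Fin n) ℂ := fun i => Matrix.single ⟨0, hn⟩ i 1
    have hv : ∀ i j, star (v i) * v j = Matrix.single i j 1 := by
      intro i j
      simp [v, Matrix.star_eq_conjTranspose]
    refine CStarMatrix.nonneg_of_form_nonneg ?_ fun u => ?_
    · refine CStarMatrix.ext fun i j => ?_
      change star (Matrix.single j i (1 : ℂ)) = Matrix.single i j 1
      simp [Matrix.star_eq_conjTranspose]
    · have h := star_mul_self_nonneg (∑ i, v i * u i)
      rw [← sum_sum_star_mul] at h
      change 0 ≤ ∑ i, ∑ j, star (u i) * (Matrix.single i j 1) * u j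
      simpa only [← hv, star_mul, mul_assoc] using h
  obtain ⟨R, hR⟩ := CStarMatrix.exists_of_nonneg (P.map_cstarMatrix_nonneg' n _ h0)
  exact ⟨R, hR⟩

theorem choiMatrix_posSemidef (hn : 1 ≤ n) : (choiMatrix P).PosSemidef := by
  obtain ⟨R, hR⟩ := exists_single_eq_sum (P := P) hn
  -- Columns are indexed by pairs `(l, m)`: `l` numbers the summands `star (R l i) * R l j` and `m`
  -- is the summation index of the matrix product.
  let T : Matrix (Fin n × Fin n) (Fin n × Fin n) ℂ :=
    Matrix.of fun x y => star (R y.1 x.2 y.2 x.1)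
  have : choiMatrix P = T * Tᴴ := by
    ext ⟨p, i⟩ ⟨q, j⟩
    simp only [choiMatrix, Matrix.of_apply, hR]
    simp [T, Matrix.mul_apply, Matrix.sum_apply, Fintype.sum_prod_type,
      Matrix.star_eq_conjTranspose]
  rw [this]
  exact Matrix.posSemidef_self_mul_conjTranspose T

/-- The columns of a factor `S` with `rank` columns give `rank` operators whose span has dimension
`rank`, so they are independent. -/
theorem exists_isKrausFamily_linearIndependent (hn : 1 ≤ n) :
    ∃ t : Fin (choiMatrix P).rank → Matrix (Fin n) (Fin n) ℂ,
      IsKrausFamily P t ∧ LinearIndependent ℂ t := by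
  obtain ⟨S, hS⟩ := (choiMatrix_posSemidef (P := P) hn).exists_eq_mul_conjTranspose
  have h : IsKrausFamily P fun r => Matrix.of fun p i => S (p, i) r := isKrausFamily_iff.2 hS
  exact ⟨_, h, linearIndependent_iff_card_eq_finrank_span.2
    (by rw [Set.finrank, finrank_span_eq_rank_choiMatrix h, Fintype.card_fin])⟩

/-- The set under the infimum is nonempty, so the infimum is attained by some representation, and
every representation has span of this dimension. -/
theorem krausIndex_eq_rank_choiMatrix (hn : 1 ≤ n) : krausIndex P = (choiMatrix P).rank := by
  obtain ⟨t, ht, -⟩ := exists_isKrausFamily_linearIndependent (P := P) hn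
  obtain ⟨N, s, hs, h⟩ := Nat.sInf_mem
    (s := {d | ∃ (N : ℕ) (t : Fin N → Matrix (Fin n) (Fin n) ℂ),
      IsKrausFamily P t ∧ Module.finrank ℂ (Submodule.span ℂ (Set.range t)) = d})
    ⟨_, _, t, ht, rfl⟩
  exact h.symm.trans (finrank_span_eq_rank_choiMatrix hs)

end Kraus

/-! ### The column space as an imprimitivity bimodule -/

section ColumnBimodule

open Matrix

variable {n : ℕ}

/-- For `a = x x⋆` one has `a⋆ a = ‖x‖² a`, and the C⋆-identity gives `‖a‖² = ‖x‖² ‖a‖`. This makes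
the norms from the two inner products on the column space agree. -/
theorem norm_vecMulVec_star (x : EuclideanSpace ℂ (Fin n)) :
    ‖(vecMulVec x.ofLp (star x.ofLp) : Matrix (Fin n) (Fin n) ℂ)‖ = ‖x‖ ^ 2 := by
  set a : Matrix (Fin n) (Fin n) ℂ := vecMulVec x.ofLp (star x.ofLp) with ha
  have h1 : star a * a = ((‖x‖ ^ 2 : ℝ) : ℂ) • a := by
    have h2 : star x.ofLp ⬝ᵥ x.ofLp = ((‖x‖ ^ 2 : ℝ) : ℂ) := by
      rw [dotProduct_comm, ← EuclideanSpace.inner_eq_star_dotProduct, inner_self_eq_norm_sq_to_K]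
      simp
    rw [ha, star_eq_conjTranspose, conjTranspose_vecMulVec, star_star, vecMulVec_mul_vecMulVec, h2]
    ext i j
    simp [vecMulVec_apply]
    ring

  have h3 : ‖a‖ * ‖a‖ = ‖x‖ ^ 2 * ‖a‖ := by
    rw [← CStarRing.norm_star_mul_self, h1, norm_smul, Complex.norm_real,
      Real.norm_of_nonneg (sq_nonneg _)]
  rcases eq_or_ne a 0 with h | h
  · have hx : x = 0 := by
      ext i
      have := congrFun (congrFun h i) i
      simpa [ha, vecMulVec_apply] using this
    simp [h, hx]
  · exact mul_right_cancel₀ (norm_ne_zero_iff.2 h) h3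

/-- The column space `ℂⁿ` as an equivalence bimodule between `Mₙ(ℂ)` and `ℂ`. -/
noncomputable def columnBimodule (hn : 1 ≤ n) :
    EquivalenceBimodule (Matrix (Fin n) (Fin n) ℂ) ℂ where
  carrier := EuclideanSpace ℂ (Fin n)
  left := (Matrix.toLpLinAlgEquiv 2 : Matrix (Fin n) (Fin n) ℂ ≃ₐ[ℂ] _).toAlgHom
  right := (Algebra.lsmul ℂ ℂ _).comp (AlgEquiv.toOpposite ℂ ℂ).symm.toAlgHom
  inner x y := inner ℂ x y
  inner_add_right := inner_add_right
  inner_smul_right c x y := inner_smul_right x y c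
  star_inner x y := inner_conj_symm y x
  inner_self_nonneg x := by
    rw [inner_self_eq_norm_sq_to_K]
    exact pow_nonneg (Complex.zero_le_real.2 (norm_nonneg x)) 2
  inner_right x y b := by
    rw [mul_comm]
    exact inner_smul_right x y b
  inner_left a x y := by
    change inner ℂ (WithLp.toLp 2 (a *ᵥ x.ofLp)) y = inner ℂ x (WithLp.toLp 2 (aᴴ *ᵥ y.ofLp))
    rw [EuclideanSpace.inner_eq_star_dotProduct, EuclideanSpace.inner_eq_star_dotProduct,
      star_mulVec, dotProduct_comm, ← dotProduct_mulVec, dotProduct_comm (aᴴ *ᵥ y.ofLp)]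
  norm_eq x := by
    rw [inner_self_eq_norm_sq_to_K]
    simp
  leftInner x y := vecMulVec x.ofLp (star y.ofLp)
  leftInner_add_left x y z := by simp [add_vecMulVec]
  leftInner_smul_left c x y := by simp [smul_vecMulVec]
  star_leftInner x y := by simp [star_eq_conjTranspose, conjTranspose_vecMulVec]
  leftInner_self_nonneg x := (posSemidef_vecMulVec_self_star x.ofLp).nonneg
  leftInner_left a x y := (mul_vecMulVec a x.ofLp (star y.ofLp)).symm
  leftInner_right b x y := by
    change vecMulVec (b • x.ofLp) (star y.ofLp) = vecMulVec x.ofLp (star (star b • y.ofLp))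
    rw [star_smul, star_star, smul_vecMulVec, vecMulVec_smul]
  norm_eq_left x := by
    rw [norm_vecMulVec_star, Real.sqrt_sq (norm_nonneg x)]
  left_leftInner x y z := by
    change WithLp.toLp 2 (vecMulVec x.ofLp (star y.ofLp) *ᵥ z.ofLp) = (inner ℂ y z : ℂ) • x
    rw [vecMulVec_mulVec, EuclideanSpace.inner_eq_star_dotProduct, dotProduct_comm]
    ext i
    simp [mul_comm]
  full_left := by
    convert dense_univ
    refine Set.eq_univ_of_forall fun a => ?_
    rw [matrix_eq_sum_single a]
    refine Submodule.sum_mem _ fun i _ => Submodule.sum_mem _ fun j _ => ?_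
    -- Each term `a_{ij} e_{ij}` is itself a left inner product, namely that of `a_{ij} e_i` and
    -- `e_j`.
    refine Submodule.subset_span
      ⟨(EuclideanSpace.single i (a i j), EuclideanSpace.single j 1), ?_⟩
    ext k l
    simp only [vecMulVec_apply, PiLp.ofLp_single, Pi.star_apply, Pi.single_apply, single_apply,
      @eq_comm _ k i, @eq_comm _ l j]
    by_cases h1 : i = k <;> by_cases h2 : j = l <;> simp [h1, h2]
  full_right := by
    convert dense_univ
    -- A coordinate is needed for fullness over `ℂ`; then `⟨e_i, a e_i⟩ = a` reaches every scalar.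
    let i : Fin n := ⟨0, hn⟩
    refine Set.eq_univ_of_forall fun a => Submodule.subset_span
      ⟨(EuclideanSpace.single i 1, EuclideanSpace.single i a), ?_⟩
    refine (EuclideanSpace.inner_single_left i 1 _).trans ?_
    rw [PiLp.single_apply, if_pos rfl, map_one, one_mul]

end ColumnBimodule

/-! ### Isomorphisms from surjections with the same inner products -/

namespace Correspondence

variable {A B : Type u} [CStarAlgebra A] [CStarAlgebra B] [PartialOrder B] [StarOrderedRing B]

theorem eq_zero_of_inner_self (E : Correspondence A B) {x : E.carrier} (h : E.inner x x = 0) :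
    x = 0 := by
  rw [← norm_eq_zero, E.norm_eq, h]
  simp

/-- A right action of `ℂ` is by scalar multiplication. -/
theorem right_eq_smul {A : Type} [CStarAlgebra A] (E : Correspondence A ℂ) (b : ℂᵐᵒᵖ)
    (x : E.carrier) : E.right b x = b.unop • x := by
  have : b = algebraMap ℂ ℂᵐᵒᵖ b.unop := rfl
  conv_lhs => rw [this, AlgHom.commutes]
  rfl

/-- Two surjections from the same space with the same inner products and intertwining the actions
induce an isomorphism of correspondences. -/
theorem nonempty_iso_of_surjective {A : Type} [CStarAlgebra A] {E F : Correspondence A ℂ}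
    {U : Type*} [AddCommGroup U] [Module ℂ U] (f : U →ₗ[ℂ] E.carrier) (g : U →ₗ[ℂ] F.carrier)
    (hf : Function.Surjective f) (hg : Function.Surjective g)
    (h : ∀ u v, E.inner (f u) (f v) = F.inner (g u) (g v)) (l : A → U → U)
    (hlf : ∀ a u, f (l a u) = E.left a (f u)) (hlg : ∀ a u, g (l a u) = F.left a (g u)) :
    Nonempty (E.Iso F) := by
  -- In either correspondence a vector vanishes exactly when its length does, and lengths of `f u`
  -- and `g u` agree.
  have hker : LinearMap.ker f = LinearMap.ker g := by
    ext u
    rw [LinearMap.mem_ker, LinearMap.mem_ker]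
    constructor <;> intro hu
    · refine F.eq_zero_of_inner_self ?_
      rw [← h, hu, ← innerₛₗ_apply, map_zero]
    · refine E.eq_zero_of_inner_self ?_
      rw [h, hu, ← innerₛₗ_apply, map_zero]
  let e : E.carrier ≃ₗ[ℂ] F.carrier := (f.quotKerEquivOfSurjective hf).symm ≪≫ₗ
    Submodule.quotEquivOfEq _ _ hker ≪≫ₗ g.quotKerEquivOfSurjective hg
  have he : ∀ u, e (f u) = g u := by
    intro u
    have : (f.quotKerEquivOfSurjective hf).symm (f u) = Submodule.Quotient.mk u := by
      rw [LinearEquiv.symm_apply_eq]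
      rfl
    simp only [e, LinearEquiv.trans_apply, this]
    rfl
  refine ⟨⟨e, fun a x => ?_, fun b x => ?_, fun x y => ?_⟩⟩
  · obtain ⟨u, rfl⟩ := hf x
    change e _ = F.left a (e _)
    rw [← hlf, he, he, hlg]
  · change e _ = F.right b (e _)
    -- Over `ℂ` the right module property is just linearity.
    rw [right_eq_smul, right_eq_smul, map_smul]
  · obtain ⟨u, rfl⟩ := hf x
    obtain ⟨v, rfl⟩ := hf y
    change F.inner (e _) (e _) = _
    rw [he, he, h]

end Correspondence

/-! ### Completions in finite dimension -/

namespace PreCorrespondence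

variable {A B : Type u} [CStarAlgebra A] [CStarAlgebra B] [PartialOrder B] [StarOrderedRing B]

/-- The canonical map of a pre-correspondence into its completion. -/
noncomputable def toCompletion (V : PreCorrespondence A B) :
    V.carrier →ₗ[ℂ] V.completion.carrier :=
  (UniformSpace.Completion.toComplL : V.carrier →L[ℂ] UniformSpace.Completion V.carrier).toLinearMap

/-- The image is dense, and it is closed because it is a finite-dimensional subspace. -/
theorem toCompletion_surjective (V : PreCorrespondence A B) [FiniteDimensional ℂ V.carrier] :
    Function.Surjective V.toCompletion := by
  rw [← LinearMap.range_eq_top]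
  have h1 : Dense (LinearMap.range V.toCompletion : Set V.completion.carrier) :=
    UniformSpace.Completion.denseRange_coe
  have h2 := Submodule.closed_of_finiteDimensional (LinearMap.range V.toCompletion)
  exact SetLike.coe_injective (h2.closure_eq.symm.trans h1.closure_eq)

theorem inner_toCompletion (V : PreCorrespondence A B) (x y : V.carrier) :
    V.completion.inner (V.toCompletion x) (V.toCompletion y) = V.inner x y :=
  V.completionInner_coe x y

theorem left_toCompletion (V : PreCorrespondence A B) (a : A) (x : V.carrier) :
    V.completion.left a (V.toCompletion x) = V.toCompletion (V.left a x) :=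
  (V.leftL a).completion_apply_coe x

end PreCorrespondence

/-! ### Interior tensor products as images of algebraic ones -/

namespace Correspondence

variable {A B C : Type u} [CStarAlgebra A] [CStarAlgebra B] [PartialOrder B] [StarOrderedRing B]
  [CStarAlgebra C] [PartialOrder C] [StarOrderedRing C]

/-- The canonical map of the algebraic tensor product into the interior tensor product. -/
noncomputable def tmulMap (E : Correspondence A B) (X : Correspondence B C) :
    E.carrier ⊗[ℂ] X.carrier →ₗ[ℂ] (E.tensor X).carrier :=
  (preTensor E X).toCompletion

theorem tmulMap_surjective (E : Correspondence A B) (X : Correspondence B C)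
    [FiniteDimensional ℂ E.carrier] [FiniteDimensional ℂ X.carrier] :
    Function.Surjective (E.tmulMap X) :=
  have : FiniteDimensional ℂ (preTensor E X).carrier :=
    inferInstanceAs (FiniteDimensional ℂ (E.carrier ⊗[ℂ] X.carrier))
  (preTensor E X).toCompletion_surjective

theorem inner_tmulMap (E : Correspondence A B) (X : Correspondence B C) (e e' : E.carrier)
    (x x' : X.carrier) :
    (E.tensor X).inner (E.tmulMap X (e ⊗ₜ x)) (E.tmulMap X (e' ⊗ₜ x'))
      = X.inner x (X.left (E.inner e e') x') :=
  (preTensor E X).inner_toCompletion _ _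

theorem left_tmulMap (E : Correspondence A B) (X : Correspondence B C) (a : A)
    (s : E.carrier ⊗[ℂ] X.carrier) :
    (E.tensor X).left a (E.tmulMap X s) = E.tmulMap X ((E.left a).rTensor X.carrier s) :=
  (preTensor E X).left_toCompletion a s

end Correspondence

/-! ### The GNS correspondence and its tensor product with a bimodule -/

section GNS

variable {A B : Type u} [CStarAlgebra A] [PartialOrder A] [StarOrderedRing A]
  [CStarAlgebra B] [PartialOrder B] [StarOrderedRing B]

/-- The canonical map of `A ⊗ B` into the GNS correspondence. -/
noncomputable def gnsMap (P : A →CP B) : A ⊗[ℂ] B →ₗ[ℂ] (gnsCorrespondence P).carrier :=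
  (gnsPreCorrespondence P).toCompletion

theorem gnsMap_surjective (P : A →CP B) [FiniteDimensional ℂ A] [FiniteDimensional ℂ B] :
    Function.Surjective (gnsMap P) :=
  have : FiniteDimensional ℂ (gnsPreCorrespondence P).carrier :=
    inferInstanceAs (FiniteDimensional ℂ (A ⊗[ℂ] B))
  (gnsPreCorrespondence P).toCompletion_surjective

theorem inner_gnsMap (P : A →CP B) (a a' : A) (b b' : B) :
    (gnsCorrespondence P).inner (gnsMap P (a ⊗ₜ b)) (gnsMap P (a' ⊗ₜ b'))
      = star b * P (star a * a') * b' :=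
  (gnsPreCorrespondence P).inner_toCompletion _ _

theorem left_gnsMap (P : A →CP B) (a : A) (s : A ⊗[ℂ] B) :
    (gnsCorrespondence P).left a (gnsMap P s) = gnsMap P ((LinearMap.mulLeft ℂ a).rTensor B s) :=
  (gnsPreCorrespondence P).left_toCompletion a s

variable {C : Type u} [CStarAlgebra C] [PartialOrder C] [StarOrderedRing C]

/-- The canonical map of `A ⊗ B ⊗ X` into the interior tensor product of the GNS correspondence
and `X`. -/
noncomputable def gnsTensorMap (P : A →CP B) (X : Correspondence B C) :
    A ⊗[ℂ] B ⊗[ℂ] X.carrier →ₗ[ℂ] ((gnsCorrespondence P).tensor X).carrier :=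
  (gnsCorrespondence P).tmulMap X ∘ₗ (gnsMap P).rTensor X.carrier

theorem gnsTensorMap_surjective (P : A →CP B) (X : Correspondence B C) [FiniteDimensional ℂ A]
    [FiniteDimensional ℂ B] [FiniteDimensional ℂ X.carrier] :
    Function.Surjective (gnsTensorMap P X) :=
  have h := gnsMap_surjective P
  have : FiniteDimensional ℂ (gnsCorrespondence P).carrier := Module.Finite.of_surjective _ h
  ((gnsCorrespondence P).tmulMap_surjective X).comp (LinearMap.rTensor_surjective _ h)

theorem inner_gnsTensorMap (P : A →CP B) (X : Correspondence B C) (a a' : A) (b b' : B)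
    (x x' : X.carrier) :
    ((gnsCorrespondence P).tensor X).inner (gnsTensorMap P X (a ⊗ₜ b ⊗ₜ x))
      (gnsTensorMap P X (a' ⊗ₜ b' ⊗ₜ x')) = X.inner x (X.left (star b * P (star a * a') * b') x') := by
  rw [← inner_gnsMap]
  exact (gnsCorrespondence P).inner_tmulMap X _ _ _ _

theorem left_gnsTensorMap (P : A →CP B) (X : Correspondence B C) (a : A)
    (s : A ⊗[ℂ] B ⊗[ℂ] X.carrier) :
    ((gnsCorrespondence P).tensor X).left a (gnsTensorMap P X s)
      = gnsTensorMap P X (((LinearMap.mulLeft ℂ a).rTensor B).rTensor X.carrier s) := by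
  have h : (gnsCorrespondence P).left a ∘ₗ gnsMap P = gnsMap P ∘ₗ (LinearMap.mulLeft ℂ a).rTensor B :=
    LinearMap.ext (left_gnsMap P a)
  have h2 := congrArg (fun f => f.rTensor X.carrier s) h
  simp only [LinearMap.rTensor_comp, LinearMap.comp_apply] at h2
  rw [gnsTensorMap, LinearMap.comp_apply, Correspondence.left_tmulMap, h2, LinearMap.comp_apply]

end GNS

/-- Two maps on `(V ⊗ W) ⊗ X` which pull back the same inner products of elementary tensors pull
back the same inner products. -/
theorem Correspondence.inner_eq_inner_of_threefold {A B : Type u} [CStarAlgebra A] [CStarAlgebra B]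
    [PartialOrder B] [StarOrderedRing B] {E F : Correspondence A B} {V W X : Type*}
    [AddCommGroup V] [Module ℂ V] [AddCommGroup W] [Module ℂ W] [AddCommGroup X] [Module ℂ X]
    {f : V ⊗[ℂ] W ⊗[ℂ] X →ₗ[ℂ] E.carrier} {g : V ⊗[ℂ] W ⊗[ℂ] X →ₗ[ℂ] F.carrier}
    (h : ∀ v w x v' w' x', E.inner (f (v ⊗ₜ w ⊗ₜ x)) (f (v' ⊗ₜ w' ⊗ₜ x'))
      = F.inner (g (v ⊗ₜ w ⊗ₜ x)) (g (v' ⊗ₜ w' ⊗ₜ x'))) (s s' : V ⊗[ℂ] W ⊗[ℂ] X) :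
    E.inner (f s) (f s') = F.inner (g s) (g s') := by
  -- As functionals of the second argument the two sides are linear, so extensionality on elementary
  -- tensors handles that argument; only the first needs induction.
  have key : E.innerₛₗ (f s) ∘ₗ f = F.innerₛₗ (g s) ∘ₗ g := by
    induction s with
    | zero => simp
    | add s s' hs hs' => simp only [map_add, LinearMap.add_comp, hs, hs']
    | tmul m x =>
      induction m with
      | zero => simp
      | add m m' hm hm' =>
        simp only [TensorProduct.add_tmul, map_add, LinearMap.add_comp, hm, hm']
      | tmul v w => exact TensorProduct.ext_threefold (h v w x)
  exact LinearMap.congr_fun key s'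

/-! ### The intertwiner built from a Kraus family -/

section Intertwiner

open Correspondence

variable {n : ℕ}

local notation "M" => Matrix (Fin n) (Fin n) ℂ
local notation "X" => EuclideanSpace ℂ (Fin n)

/-- The map `a ⊗ b ⊗ x ↦ a t b x`. -/
noncomputable def sandwichMap (t : M) : M ⊗[ℂ] M ⊗[ℂ] X →ₗ[ℂ] X :=
  TensorProduct.lift ((Matrix.toLpLinAlgEquiv 2 : M ≃ₐ[ℂ] _).toLinearMap ∘ₗ
    LinearMap.mul' ℂ M ∘ₗ (LinearMap.mulRight ℂ t).rTensor M)

theorem sandwichMap_tmul (t a b : M) (x : X) :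
    sandwichMap t (a ⊗ₜ b ⊗ₜ x) = WithLp.toLp 2 ((a * t * b).mulVec x.ofLp) := rfl

/-- The map `a ⊗ b ⊗ x ↦ ∑ r, (a (t r)⋆ b x) ⊗ e_r`. -/
noncomputable def krausMap {N : ℕ} (t : Fin N → M) :
    M ⊗[ℂ] M ⊗[ℂ] X →ₗ[ℂ] X ⊗[ℂ] EuclideanSpace ℂ (Fin N) :=
  ∑ r, (TensorProduct.mk ℂ X (EuclideanSpace ℂ (Fin N))).flip (EuclideanSpace.single r 1) ∘ₗ
    sandwichMap (star (t r))

theorem krausMap_apply {N : ℕ} (t : Fin N → M) (s : M ⊗[ℂ] M ⊗[ℂ] X) :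
    krausMap t s = ∑ r, sandwichMap (star (t r)) s ⊗ₜ EuclideanSpace.single r 1 := by
  simp [krausMap]

/-- For fixed `x`, the vectors `w` with `x ⊗ w` in the range form a subspace `W` of `ℂᴺ`. It
contains every vector of conjugated `(k, j)` entries of the `t r`, and independence of `t` forces
the orthogonal complement of these to be zero. -/
theorem krausMap_surjective {N : ℕ} {t : Fin N → M} (ht : LinearIndependent ℂ t) :
    Function.Surjective (krausMap t) := by
  have key : ∀ (x : X) (w : EuclideanSpace ℂ (Fin N)), x ⊗ₜ w ∈ LinearMap.range (krausMap t) := by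
    intro x
    let W : Submodule ℂ (EuclideanSpace ℂ (Fin N)) :=
      (LinearMap.range (krausMap t)).comap (TensorProduct.mk ℂ X (EuclideanSpace ℂ (Fin N)) x)
    have hmem : ∀ j k, (WithLp.toLp 2 fun r => star (t r k j)) ∈ W := by
      intro j k
      -- With `a = x e_jᵀ` and `b = 1`, the vector `a (t r)⋆ e_k` is `x` times the `(j, k)` entry of
      -- `(t r)⋆`.
      refine ⟨Matrix.vecMulVec x.ofLp (Pi.single j 1) ⊗ₜ 1 ⊗ₜ EuclideanSpace.single k 1, ?_⟩
      have h1 : ∀ r, sandwichMap (star (t r)) (Matrix.vecMulVec x.ofLp (Pi.single j 1) ⊗ₜ 1 ⊗ₜ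
          EuclideanSpace.single k 1) = star (t r k j) • x := by
        intro r
        rw [sandwichMap_tmul]
        ext i
        simp [Matrix.vecMulVec_mul, Matrix.vecMulVec_apply, Matrix.star_eq_conjTranspose, mul_comm]
      have h2 : (WithLp.toLp 2 fun r => star (t r k j) : EuclideanSpace ℂ (Fin N))
          = ∑ r, star (t r k j) • EuclideanSpace.single r 1 := by
        ext s
        simp [Pi.single_apply]
      rw [krausMap_apply, TensorProduct.mk_apply, h2, TensorProduct.tmul_sum]
      refine Finset.sum_congr rfl fun r _ => ?_
      rw [h1, TensorProduct.smul_tmul]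
    have hW : Wᗮ = ⊥ := by
      refine (Submodule.eq_bot_iff _).2 fun c hc => ?_
      -- The inner product conjugates its first argument, so orthogonality to the vector for `(k,
      -- j)` is the vanishing of the `(k, j)` entry of this sum.
      have h3 : ∑ r, c r • t r = 0 := by
        ext k j
        have h4 := (Submodule.mem_orthogonal W c).1 hc _ (hmem j k)
        rw [PiLp.inner_apply] at h4
        simpa [Matrix.sum_apply] using h4
      ext r
      exact Fintype.linearIndependent_iff.1 ht _ h3 r
    intro w
    have : w ∈ W := by
      rw [W.orthogonal_eq_bot_iff.1 hW]
      trivial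
    exact this
  rw [← LinearMap.range_eq_top, eq_top_iff, ← TensorProduct.span_tmul_eq_top]
  refine Submodule.span_le.2 ?_
  rintro _ ⟨x, w, rfl⟩
  exact key x w

theorem krausMap_left {N : ℕ} (t : Fin N → M) (a : M) (s : M ⊗[ℂ] M ⊗[ℂ] X) :
    krausMap t (((LinearMap.mulLeft ℂ a).rTensor M).rTensor X s)
      = (Matrix.toLpLinAlgEquiv 2 a : Module.End ℂ X).rTensor _ (krausMap t s) := by
  rw [krausMap_apply, krausMap_apply, map_sum]
  refine Finset.sum_congr rfl fun r _ => ?_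
  rw [LinearMap.rTensor_tmul]
  congr 1
  have h : sandwichMap (star (t r)) ∘ₗ ((LinearMap.mulLeft ℂ a).rTensor M).rTensor X
      = (Matrix.toLpLinAlgEquiv 2 a : Module.End ℂ X) ∘ₗ sandwichMap (star (t r)) := by
    refine TensorProduct.ext_threefold fun b c x => ?_
    change sandwichMap (star (t r)) ((a * b) ⊗ₜ c ⊗ₜ x)
      = WithLp.toLp 2 (a.mulVec (sandwichMap (star (t r)) (b ⊗ₜ c ⊗ₜ x)).ofLp)
    simp [sandwichMap_tmul, Matrix.mulVec_mulVec, mul_assoc]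
  exact LinearMap.congr_fun h s

/-- The canonical map of `M ⊗ M ⊗ X` into the interior tensor product of `X` and `ℂᴺ`. -/
noncomputable def krausTensorMap (hn : 1 ≤ n) {N : ℕ} (t : Fin N → M) :
    M ⊗[ℂ] M ⊗[ℂ] (columnBimodule hn).carrier →ₗ[ℂ] ((columnBimodule hn).toCorrespondence.tensor
      (hilbertSpaceCorrespondence (EuclideanSpace ℂ (Fin N)))).carrier :=
  (columnBimodule hn).toCorrespondence.tmulMap
    (hilbertSpaceCorrespondence (EuclideanSpace ℂ (Fin N))) ∘ₗ krausMap t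

instance (hn : 1 ≤ n) : FiniteDimensional ℂ (columnBimodule hn).carrier :=
  inferInstanceAs (FiniteDimensional ℂ X)

theorem krausTensorMap_surjective (hn : 1 ≤ n) {N : ℕ} {t : Fin N → M}
    (ht : LinearIndependent ℂ t) : Function.Surjective (krausTensorMap hn t) :=
  have : FiniteDimensional ℂ
      (hilbertSpaceCorrespondence (EuclideanSpace ℂ (Fin N))).carrier :=
    inferInstanceAs (FiniteDimensional ℂ (EuclideanSpace ℂ (Fin N)))
  ((columnBimodule hn).toCorrespondence.tmulMap_surjective
    (hilbertSpaceCorrespondence (EuclideanSpace ℂ (Fin N)))).comp (krausMap_surjective ht)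

theorem left_krausTensorMap (hn : 1 ≤ n) {N : ℕ} (t : Fin N → M) (a : M)
    (s : M ⊗[ℂ] M ⊗[ℂ] (columnBimodule hn).carrier) :
    ((columnBimodule hn).toCorrespondence.tensor
      (hilbertSpaceCorrespondence (EuclideanSpace ℂ (Fin N)))).left a (krausTensorMap hn t s)
      = krausTensorMap hn t
        (((LinearMap.mulLeft ℂ a).rTensor M).rTensor (columnBimodule hn).carrier s) :=
  (left_tmulMap (columnBimodule hn).toCorrespondence
    (hilbertSpaceCorrespondence (EuclideanSpace ℂ (Fin N))) a _).trans
    (congrArg _ (krausMap_left t a s).symm)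

/-- The right-hand side is also the inner product of the corresponding vectors in the GNS tensor
product. Orthonormality of the `e_r` leaves one sum over `r`, and moving `a (t r)⋆ b` across the
inner product puts `t r * (a⋆ a') * (t r)⋆` in the middle, which sums to `P(a⋆ a')`. -/
theorem inner_krausTensorMap (hn : 1 ≤ n) {N : ℕ} {t : Fin N → M} {P : M →CP M}
    (h : IsKrausFamily P t) (a b a' b' : M) (x x' : (columnBimodule hn).carrier) :
    ((columnBimodule hn).toCorrespondence.tensor
      (hilbertSpaceCorrespondence (EuclideanSpace ℂ (Fin N)))).inner
      (krausTensorMap hn t (a ⊗ₜ b ⊗ₜ x)) (krausTensorMap hn t (a' ⊗ₜ b' ⊗ₜ x'))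
      = (columnBimodule hn).inner x
        ((columnBimodule hn).left (star b * P (star a * a') * b') x') := by
  change X at x x'
  let Y := (columnBimodule hn).toCorrespondence
  let H := hilbertSpaceCorrespondence (EuclideanSpace ℂ (Fin N))
  -- The interior tensor product `X ⊗ ℂᴺ` behaves as `N` orthogonal copies of `X`.
  have h1 : ∀ (y : Fin N → X) (z : Fin N → X),
      (Y.tensor H).inner (Y.tmulMap H (∑ r, y r ⊗ₜ EuclideanSpace.single r 1))
        (Y.tmulMap H (∑ r, z r ⊗ₜ EuclideanSpace.single r 1)) = ∑ r, inner ℂ (y r) (z r) := by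
    intro y z
    refine (congrArg₂ (Y.tensor H).inner (map_sum (Y.tmulMap H) _ _)
      (map_sum (Y.tmulMap H) _ _)).trans ?_
    rw [inner_sum_sum]
    refine Finset.sum_congr rfl fun r _ => ?_
    rw [Finset.sum_eq_single r]
    · refine (inner_tmulMap Y H _ _ _ _).trans ?_
      change inner ℂ (EuclideanSpace.single r (1 : ℂ))
        ((inner ℂ (y r) (z r) : ℂ) • EuclideanSpace.single r (1 : ℂ)) = _
      simp
    · intro s _ hs
      refine (inner_tmulMap Y H _ _ _ _).trans ?_
      change inner ℂ (EuclideanSpace.single r (1 : ℂ))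
        ((inner ℂ (y r) (z s) : ℂ) • EuclideanSpace.single s (1 : ℂ)) = _
      rw [_root_.inner_smul_right, EuclideanSpace.inner_single_left]
      simp [hs.symm]
    · simp
  refine (congrArg₂ (fun u v => (Y.tensor H).inner (Y.tmulMap H u) (Y.tmulMap H v))
    (krausMap_apply t (a ⊗ₜ b ⊗ₜ x)) (krausMap_apply t (a' ⊗ₜ b' ⊗ₜ x'))).trans ?_
  refine (h1 _ _).trans ?_
  change _ = inner ℂ x (WithLp.toLp 2 ((star b * P (star a * a') * b').mulVec x'.ofLp))
  have h2 : ∀ r, inner ℂ (sandwichMap (star (t r)) (a ⊗ₜ b ⊗ₜ x))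
      (sandwichMap (star (t r)) (a' ⊗ₜ b' ⊗ₜ x'))
      = inner ℂ x (WithLp.toLp 2
        ((star b * (t r * (star a * a') * star (t r)) * b').mulVec x'.ofLp)) := by
    intro r
    refine (Y.inner_left (a * star (t r) * b) x _).trans ?_
    change inner ℂ x (WithLp.toLp 2 ((star (a * star (t r) * b)).mulVec
      ((a' * star (t r) * b').mulVec x'.ofLp))) = _
    rw [Matrix.mulVec_mulVec]
    simp only [star_mul, star_star, mul_assoc]
  simp only [h2]
  rw [h, Finset.mul_sum, Finset.sum_mul, Matrix.sum_mulVec, WithLp.toLp_sum, inner_sum]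

/-- The Kraus formula matches the inner products; independence enters only through surjectivity onto
`X ⊗ ℂᴺ`. -/
theorem nonempty_iso_of_isKrausFamily (hn : 1 ≤ n) {N : ℕ} {t : Fin N → M} {P : M →CP M}
    (h : IsKrausFamily P t) (ht : LinearIndependent ℂ t) :
    Nonempty (((gnsCorrespondence P).tensor (columnBimodule hn).toCorrespondence).Iso
      ((columnBimodule hn).toCorrespondence.tensor
        (hilbertSpaceCorrespondence (EuclideanSpace ℂ (Fin N))))) :=
  nonempty_iso_of_surjective (gnsTensorMap P (columnBimodule hn).toCorrespondence)
    (krausTensorMap hn t) (gnsTensorMap_surjective P _) (krausTensorMap_surjective hn ht)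
    (inner_eq_inner_of_threefold fun a b x a' b' x' =>
      (inner_gnsTensorMap P _ a a' b b' x x').trans
        (inner_krausTensorMap hn h a b a' b' x x').symm)
    (fun a => ((LinearMap.mulLeft ℂ a).rTensor M).rTensor (columnBimodule hn).carrier)
    (fun a s => (left_gnsTensorMap P _ a s).symm) (fun a s => (left_krausTensorMap hn t a s).symm)

end Intertwiner

theorem theorem1 {n : ℕ} (hn : 1 ≤ n)
    (P : Matrix (Fin n) (Fin n) ℂ →CP Matrix (Fin n) (Fin n) ℂ) :
    (∃ (N : ℕ) (t : Fin N → Matrix (Fin n) (Fin n) ℂ), IsKrausFamily P t) ∧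
    (∀ (N : ℕ) (t : Fin N → Matrix (Fin n) (Fin n) ℂ), IsKrausFamily P t →
      Module.finrank ℂ (Submodule.span ℂ (Set.range t)) = krausIndex P) ∧
    StronglyMoritaEquivalent (gnsCorrespondence P)
      (hilbertSpaceCorrespondence (EuclideanSpace ℂ (Fin (krausIndex P)))) := by
  -- The Hilbert space is then indexed by the same `Fin` type as the independent Kraus family.
  rw [krausIndex_eq_rank_choiMatrix hn]
  obtain ⟨t, ht, hli⟩ := exists_isKrausFamily_linearIndependent (P := P) hn
  exact ⟨⟨_, t, ht⟩, fun _ _ hs => finrank_span_eq_rank_choiMatrix hs,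
    columnBimodule hn, nonempty_iso_of_isKrausFamily hn ht hli⟩
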